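/- Theorem. Consider a set of $n$ products with unit prices $r_i \ge 0$ and starting inventory $c\in\mathbb{Z}_{\ge 0}^n$, a deterministic number $T$ of customers arriving one after another, and $m$ customer types. Customer $t$ is, independently of everything else, of type $k$ with known probability $\lambda_{k,t}$ ($\sum_k\lambda_{k,t}=1$ for every $t$); let $\lambda_k=\frac1T\sum_{t=1}^T\lambda_{k,t}$, so that $T\lambda_k$ is the expected number of customers of type $k$. A customer of type $k$ who is offered the assortment $S\subseteq N=\{1,\dots,n\}$ buys one unit of product $i$ with probability $\phi_k(i,S)$ and nothing with the remaining probability, where $\phi_k(i,S)\ge 0$, $\phi_k(i,S)=0$ for $i\notin S$, and $\sum_{i\in S}\phi_k(i,S)\le 1$. Assume that every $\phi_k$ satisfies weak substitutability: $\phi_k(i,S')\le\phi_k(i,S)$ whenever $i\in S\subseteq S'\subseteq N$. Write $R_k(S)=\sum_{i\in S}r_i\phi_k(i,S)$, and let $$f^{M}_{LP}(c,T)=\max_{y\ge 0}\Big\{\,T\sum_{k}\lambda_k\sum_{S\subseteq N}y_k(S)R_k(S)\ :\ T\sum_k\lambda_k\sum_{S\subseteq N}y_k(S)\phi_k(i,S)\le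 c_i\ \ \forall i\in N,\ \ \sum_{S\subseteq N}y_k(S)=1\ \ \forall k\Big\}$$ be the optimal value of the multi-type choice-based linear program (CDLP). Then an optimal solution exists, and for every optimal solution $y$ the following holds. Let $f(c,T)$ be the expected total revenue of the policy that, when customer $t$ arrives and is of type $k$, samples an assortment $S_t$ with $\Pr(S_t=S)=y_k(S)$ (independently of the past) and offers $S_t\cap N_t$, where $N_t$ is the set of products that still have at least one unit of inventory left. Then $$f(c,T)\ \ge\ \Big(1-\frac1e\Big)\,f^{M}_{LP}(c,T).$$ -/

import Mathlib

open scoped Finset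

/-- A choice model on the products `Fin n`: `prob i S` is the probability that a customer who is
offered the assortment `S` buys product `i`.  The remaining mass `1 - ∑ i, prob i S` is the
probability that the customer buys nothing. -/
structure ChoiceModel (n : ℕ) where
  prob : Fin n → Finset (Fin n) → ℝ
  prob_nonneg : ∀ i S, 0 ≤ prob i S
  prob_eq_zero : ∀ i S, i ∉ S → prob i S = 0
  sum_prob_le_one : ∀ S, ∑ i, prob i S ≤ 1

namespace ChoiceModel

variable {n : ℕ}

/-- Weak substitutability: enlarging the assortment never increases the purchase probability of a
product that was already offered. -/
def WeaklySubstitutable (φ : ChoiceModel n) : Prop :=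
  ∀ (S S' : Finset (Fin n)) (i : Fin n), S ⊆ S' → i ∈ S → φ.prob i S' ≤ φ.prob i S

/-- Probability of each outcome of the choice from the assortment `S`: `some i` is a purchase of
product `i`, and `none` is no purchase. -/
def outcomeProb (φ : ChoiceModel n) (S : Finset (Fin n)) : Option (Fin n) → ℝ
  | some i => φ.prob i S
  | none => 1 - ∑ i, φ.prob i S

/-- Expected revenue from one customer who is offered the assortment `S`, at prices `r`. -/
def expRevenue (φ : ChoiceModel n) (r : Fin n → ℝ) (S : Finset (Fin n)) : ℝ :=
  ∑ i ∈ S, r i * φ.prob i S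

end ChoiceModel

/-- The dynamic assortment problem with personalization, for `n` products, `m` customer types and a
deterministic number `T` of customers: prices, starting inventory, the probability
`typeProb t k` that customer `t` is of type `k`, and one choice model for each type. -/
structure PersonalizedAssortmentProblem (n m T : ℕ) where
  price : Fin n → ℝ
  price_nonneg : ∀ i, 0 ≤ price i
  inventory : Fin n → ℕ
  typeProb : Fin T → Fin m → ℝ
  typeProb_nonneg : ∀ t k, 0 ≤ typeProb t k
  sum_typeProb : ∀ t, ∑ k, typeProb t k = 1
  choice : Fin m → ChoiceModel n

namespace PersonalizedAssortmentProblem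

noncomputable section

variable {n m T : ℕ}

/-- The average `λ_k` over the customers `t` of the probability that customer `t` is of type `k`,
so that `T * λ_k` is the expected number of customers of type `k`. -/
def avgTypeProb (P : PersonalizedAssortmentProblem n m T) (k : Fin m) : ℝ :=
  (∑ t, P.typeProb t k) / T

/-! ### The multi-type choice-based linear program; `y k S` is the probability with which
assortment `S` is offered to a customer of type `k`. -/

/-- Feasible solutions of the multi-type CDLP. -/
structure CDLPFeasible (P : PersonalizedAssortmentProblem n m T)
    (y : Fin m → Finset (Fin n) → ℝ) : Prop where
  nonneg : ∀ k S, 0 ≤ y k S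
  sum_eq_one : ∀ k, ∑ S, y k S = 1
  inventory_le : ∀ i,
    (T : ℝ) * ∑ k, P.avgTypeProb k * ∑ S, y k S * (P.choice k).prob i S ≤ P.inventory i

/-- Objective function of the multi-type CDLP. -/
def cdlpObjective (P : PersonalizedAssortmentProblem n m T)
    (y : Fin m → Finset (Fin n) → ℝ) : ℝ :=
  (T : ℝ) * ∑ k, P.avgTypeProb k * ∑ S, y k S * (P.choice k).expRevenue P.price S

/-- Optimal solutions of the multi-type CDLP. -/
def CDLPOptimal (P : PersonalizedAssortmentProblem n m T)
    (y : Fin m → Finset (Fin n) → ℝ) : Prop :=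
  P.CDLPFeasible y ∧ ∀ y', P.CDLPFeasible y' → P.cdlpObjective y' ≤ P.cdlpObjective y

/-- The optimal value of the multi-type CDLP. -/
def cdlpValue (P : PersonalizedAssortmentProblem n m T) : ℝ :=
  sSup {v | ∃ y, P.CDLPFeasible y ∧ P.cdlpObjective y = v}

/-! ### The policy that samples an assortment and intersects it with the available products -/

/-- What happens with one customer: the type, the sampled assortment (before the intersection with
the available products), and the purchase (`none` for no purchase). -/
abbrev CustomerRecord (n m : ℕ) := Fin m × Finset (Fin n) × Option (Fin n)

/-- The products that are available to customer `t` on the sample path `ω`: those of which the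
customers before `t` have bought fewer units than the starting inventory. -/
def available (P : PersonalizedAssortmentProblem n m T) (ω : Fin T → CustomerRecord n m)
    (t : Fin T) : Finset (Fin n) :=
  {i | #{s : Fin T | s < t ∧ (ω s).2.2 = some i} < P.inventory i}

/-- Probability of the sample path `ω` under the policy.  Given the history, customer `t` is of
type `k` with probability `typeProb t k`, the assortment `S` is sampled with probability `y k S`,
and the purchase is made from `S ∩ available` according to the choice model of type `k`. -/
def pathProb (P : PersonalizedAssortmentProblem n m T) (y : Fin m → Finset (Fin n) → ℝ)
    (ω : Fin T → CustomerRecord n m) : ℝ :=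
  ∏ t, P.typeProb t (ω t).1 * y (ω t).1 (ω t).2.1 *
    (P.choice (ω t).1).outcomeProb ((ω t).2.1 ∩ P.available ω t) (ω t).2.2

/-- Expected number of units of product `i` that are sold under the policy. -/
def expSales (P : PersonalizedAssortmentProblem n m T) (y : Fin m → Finset (Fin n) → ℝ)
    (i : Fin n) : ℝ :=
  ∑ ω : Fin T → CustomerRecord n m, P.pathProb y ω * #{t : Fin T | (ω t).2.2 = some i}

/-- Expected total revenue of the policy. -/
def expRevenue (P : PersonalizedAssortmentProblem n m T) (y : Fin m → Finset (Fin n) → ℝ) : ℝ :=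
  ∑ i, P.price i * P.expSales y i

end

end PersonalizedAssortmentProblem

/-!
The expected future sales of one product are compared with the potential
`expSaturation c x = c * (1 - exp (-x / c))`, where `c` is the remaining stock and `x` the total
demand probability of the customers still to come.  By weak substitutability a product in stock is
bought with at least its demand probability, and the inequality
`exp (-x / (d + 1)) ≤ 1 + expSaturation d x - expSaturation (d + 1) x`
says that the unit sold makes up for the stock it uses, so the potential never exceeds the expected
future sales.  Feasibility bounds the initial demand by the initial stock, and there convexity of
`exp` gives `(1 - 1 / e) * x ≤ expSaturation c x`.
-/

/-- The function `c (1 - exp (-x / c))`, which serves as a lower bound for the expected sales of a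
product with stock `c` and total demand `x`.  Its value at `c = 0` is `0`. -/
noncomputable def expSaturation (c x : ℝ) : ℝ :=
  c * (1 - Real.exp (-x / c))

@[simp]
theorem expSaturation_zero_left (x : ℝ) : expSaturation 0 x = 0 := by
  simp [expSaturation]

@[simp]
theorem expSaturation_zero_right (c : ℝ) : expSaturation c 0 = 0 := by
  simp [expSaturation]

theorem expSaturation_add_le {c : ℝ} (hc : 0 < c) (p x : ℝ) :
    expSaturation c (p + x) ≤ expSaturation c x + p * Real.exp (-x / c) := by
  have hexp : Real.exp (-(p + x) / c) = Real.exp (-x / c) * Real.exp (-p / c) := by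
    rw [← Real.exp_add]
    ring_nf
  calc expSaturation c (p + x)
      = expSaturation c x + c * Real.exp (-x / c) * (1 - Real.exp (-p / c)) := by
        rw [expSaturation, expSaturation, hexp]
        ring
    _ ≤ expSaturation c x + c * Real.exp (-x / c) * (p / c) := by
        gcongr
        linarith [Real.add_one_le_exp (-p / c), neg_div c p]
    _ = expSaturation c x + p * Real.exp (-x / c) := by
        field_simp

theorem exp_le_one_add_expSaturation_sub {d x : ℝ} (hd : 0 ≤ d) (hx : 0 ≤ x) :
    Real.exp (-x / (d + 1)) ≤ 1 + expSaturation d x - expSaturation (d + 1) x := by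
  have hmono : d * Real.exp (-x / d) ≤ d * Real.exp (-x / (d + 1)) := by
    rcases hd.eq_or_lt with rfl | hd
    · simp
    · rw [neg_div, neg_div]
      gcongr
      linarith
  simp only [expSaturation]
  linarith

theorem expSaturation_succ_add_le {d x p q : ℝ} (hd : 0 ≤ d) (hx : 0 ≤ x) (hq : 0 ≤ q)
    (hpq : p ≤ q) :
    expSaturation (d + 1) (p + x) ≤
      q * (1 + expSaturation d x) + (1 - q) * expSaturation (d + 1) x :=
  calc expSaturation (d + 1) (p + x)
      ≤ expSaturation (d + 1) x + p * Real.exp (-x / (d + 1)) :=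
        expSaturation_add_le (by positivity) p x
    _ ≤ expSaturation (d + 1) x + q * (1 + expSaturation d x - expSaturation (d + 1) x) := by
        gcongr
        exact exp_le_one_add_expSaturation_sub hd hx
    _ = q * (1 + expSaturation d x) + (1 - q) * expSaturation (d + 1) x := by ring

theorem one_sub_one_div_exp_one_mul_le_expSaturation {c x : ℝ} (hx : 0 ≤ x) (hxc : x ≤ c) :
    (1 - 1 / Real.exp 1) * x ≤ expSaturation c x := by
  rcases (hx.trans hxc).eq_or_lt with rfl | hc
  · simp [le_antisymm hxc hx]
  have hconvex : Real.exp (-x / c) ≤ 1 - x / c + x / c * Real.exp (-1) := by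
    have h := convexOn_exp.2 (Set.mem_univ 0) (Set.mem_univ (-1))
      (sub_nonneg.2 ((div_le_one hc).2 hxc)) (div_nonneg hx hc.le) (sub_add_cancel _ _)
    simpa [neg_div] using h
  calc (1 - 1 / Real.exp 1) * x = c * (1 - (1 - x / c + x / c * Real.exp (-1))) := by
        rw [Real.exp_neg]
        field_simp
        ring
    _ ≤ expSaturation c x := by
        unfold expSaturation
        gcongr

theorem sum_mul_ite_of_sum_eq_one {α : Type*} [Fintype α] {w : α → ℝ} (hw : ∑ a, w a = 1)
    (A : α → Prop) [DecidablePred A] (u v : ℝ) :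
    ∑ a, w a * (if A a then u else v) =
      (∑ a with A a, w a) * u + (1 - ∑ a with A a, w a) * v := by
  have hcompl : ∑ a with ¬A a, w a = 1 - ∑ a with A a, w a := by
    rw [← hw, ← Finset.sum_filter_add_sum_filter_not Finset.univ A, add_sub_cancel_left]
  simp only [mul_ite, Finset.sum_ite, ← Finset.sum_mul, hcompl]

theorem card_filter_cons {α : Type*} (A : α → Prop) [DecidablePred A] (a : α) {r : ℕ}
    (h : Fin r → α) :
    #{s | A ((Fin.cons a h : Fin (r + 1) → α) s)} = (if A a then 1 else 0) + #{s | A (h s)} := by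
  simp [Fin.card_filter_univ_succ']

/-- The law of a sequence of `T` random elements of a finite type: `cond t h a` is the conditional
probability that entry `t` is `a`, given that the entries before it are `h`. -/
structure SequenceLaw (α : Type*) [Fintype α] (T : ℕ) where
  cond : (t : Fin T) → (Fin t → α) → α → ℝ
  cond_nonneg : ∀ t h a, 0 ≤ cond t h a
  sum_cond : ∀ t h, ∑ a, cond t h a = 1

namespace SequenceLaw

variable {α : Type*} [Fintype α] {T : ℕ}

/-- The probability of the sequence `ω`. -/
def prob (μ : SequenceLaw α T) (ω : Fin T → α) : ℝ :=
  ∏ t, μ.cond t (Fin.take t t.is_le' ω) (ω t)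

/-- The expectation of a function of the sequence. -/
def expect (μ : SequenceLaw α T) (F : (Fin T → α) → ℝ) : ℝ :=
  ∑ ω, μ.prob ω * F ω

/-- The law of the first entry. -/
def headProb (μ : SequenceLaw α (T + 1)) (a : α) : ℝ :=
  μ.cond 0 Fin.elim0 a

/-- The conditional law of the remaining entries, given that the first entry is `a`. -/
def tail (μ : SequenceLaw α (T + 1)) (a : α) : SequenceLaw α T where
  cond t h := μ.cond t.succ (Fin.cons a h)
  cond_nonneg _ _ := μ.cond_nonneg _ _
  sum_cond _ _ := μ.sum_cond _ _

theorem prob_nonneg (μ : SequenceLaw α T) (ω : Fin T → α) : 0 ≤ μ.prob ω :=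
  Finset.prod_nonneg fun _ _ => μ.cond_nonneg _ _ _

theorem headProb_nonneg (μ : SequenceLaw α (T + 1)) (a : α) : 0 ≤ μ.headProb a :=
  μ.cond_nonneg _ _ a

theorem sum_headProb (μ : SequenceLaw α (T + 1)) : ∑ a, μ.headProb a = 1 :=
  μ.sum_cond _ _

theorem prob_cons (μ : SequenceLaw α (T + 1)) (a : α) (ω : Fin T → α) :
    μ.prob (Fin.cons a ω : Fin (T + 1) → α) = μ.headProb a * (μ.tail a).prob ω := by
  have htake (t : Fin T) :
      Fin.take (t + 1) t.succ.is_le' (Fin.cons a ω : Fin (T + 1) → α) =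
        (Fin.cons a (Fin.take t t.is_le' ω) : Fin (t + 1) → α) :=
    funext fun s => Fin.cases rfl (fun _ => rfl) s
  have hzero : Fin.take 0 (Nat.zero_le _) (Fin.cons a ω : Fin (T + 1) → α) = Fin.elim0 :=
    Subsingleton.elim _ _
  rw [prob, Fin.prod_univ_succ]
  congr 1
  · exact congrArg (μ.cond 0 · a) hzero
  · exact Finset.prod_congr rfl fun t _ => congrArg (μ.cond t.succ · (ω t)) (htake t)

theorem expect_succ (μ : SequenceLaw α (T + 1)) (F : (Fin (T + 1) → α) → ℝ) :
    μ.expect F =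
      ∑ a, μ.headProb a * (μ.tail a).expect fun ω => F (Fin.cons a ω) := by
  have hcons : ∑ ω, μ.prob ω * F ω =
      ∑ a, ∑ ω : Fin T → α, μ.prob (Fin.cons a ω) * F (Fin.cons a ω) := by
    rw [← (Fin.consEquiv fun _ : Fin (T + 1) => α).sum_comp, Fintype.sum_prod_type]
    rfl
  simp only [expect, hcons, prob_cons, Finset.mul_sum, mul_assoc]

theorem sum_prob (μ : SequenceLaw α T) : ∑ ω, μ.prob ω = 1 := by
  induction T with
  | zero => simp [prob]
  | succ T ih =>
    have h := μ.expect_succ fun _ => 1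
    simpa only [expect, mul_one, ih, μ.sum_headProb] using h

theorem expect_const_add (μ : SequenceLaw α T) (b : ℝ) (F : (Fin T → α) → ℝ) :
    (μ.expect fun ω => b + F ω) = b + μ.expect F := by
  simp only [expect, mul_add, Finset.sum_add_distrib, ← Finset.sum_mul, sum_prob, one_mul]

theorem expect_nonneg (μ : SequenceLaw α T) {F : (Fin T → α) → ℝ} (hF : ∀ ω, 0 ≤ F ω) :
    0 ≤ μ.expect F :=
  Finset.sum_nonneg fun ω _ => mul_nonneg (μ.prob_nonneg ω) (hF ω)

theorem expSaturation_le_expect_card (μ : SequenceLaw α T) (A : α → Prop) [DecidablePred A]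
    (c : ℕ) {p : Fin T → ℝ} (hp : ∀ t, 0 ≤ p t)
    (hcond : ∀ t h, #{s | A (h s)} < c → p t ≤ ∑ a with A a, μ.cond t h a) :
    expSaturation c (∑ t, p t) ≤ μ.expect fun ω => #{t | A (ω t)} := by
  induction T generalizing c with
  | zero => simp [expect]
  | succ T ih =>
    rcases c with - | d
    · simpa using μ.expect_nonneg fun ω => Nat.cast_nonneg _
    set x := ∑ t : Fin T, p t.succ
    have htail (a : α) :
        (if A a then 1 + expSaturation d x else expSaturation (d + 1 : ℕ) x) ≤
          (μ.tail a).expect fun ω => #{t | A ((Fin.cons a ω : Fin (T + 1) → α) t)} := by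
      simp only [card_filter_cons, Nat.cast_add, expect_const_add]
      split_ifs with ha
      · simpa using ih (μ.tail a) d (fun t => hp t.succ) fun t h hlt =>
          hcond t.succ (Fin.cons a h) (by simpa [card_filter_cons, ha, add_comm 1] using hlt)
      · simpa using ih (μ.tail a) (d + 1) (fun t => hp t.succ) fun t h hlt =>
          hcond t.succ (Fin.cons a h) (by simpa [card_filter_cons, ha] using hlt)
    have hhead : p 0 ≤ ∑ a with A a, μ.headProb a :=
      hcond 0 Fin.elim0 <|
        ((Finset.card_le_univ _).trans (Fintype.card_fin 0).le).trans_lt d.succ_pos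
    calc expSaturation (d + 1 : ℕ) (∑ t, p t)
        ≤ ∑ a, μ.headProb a *
            (if A a then 1 + expSaturation d x else expSaturation (d + 1 : ℕ) x) := by
          rw [sum_mul_ite_of_sum_eq_one μ.sum_headProb, Fin.sum_univ_succ, Nat.cast_succ]
          exact expSaturation_succ_add_le d.cast_nonneg (Finset.sum_nonneg fun t _ => hp t.succ)
            (Finset.sum_nonneg fun a _ => μ.headProb_nonneg a) hhead
      _ ≤ μ.expect fun ω => #{t | A (ω t)} := by
          rw [expect_succ]
          exact Finset.sum_le_sum fun a _ =>
            mul_le_mul_of_nonneg_left (htail a) (μ.headProb_nonneg a)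

end SequenceLaw

namespace ChoiceModel

variable {n : ℕ} (φ : ChoiceModel n)

theorem outcomeProb_nonneg (S : Finset (Fin n)) (o : Option (Fin n)) :
    0 ≤ φ.outcomeProb S o := by
  cases o with
  | none => exact sub_nonneg.2 (φ.sum_prob_le_one S)
  | some i => exact φ.prob_nonneg i S

theorem sum_outcomeProb (S : Finset (Fin n)) : ∑ o, φ.outcomeProb S o = 1 := by
  simp [Fintype.sum_option, outcomeProb]

theorem expRevenue_eq_sum_univ (r : Fin n → ℝ) (S : Finset (Fin n)) :
    φ.expRevenue r S = ∑ i, r i * φ.prob i S :=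
  Finset.sum_subset S.subset_univ fun i _ hi => by rw [φ.prob_eq_zero i S hi, mul_zero]

variable {φ}

theorem WeaklySubstitutable.prob_le_prob_inter (hφ : φ.WeaklySubstitutable) {i : Fin n}
    {A : Finset (Fin n)} (hi : i ∈ A) (S : Finset (Fin n)) : φ.prob i S ≤ φ.prob i (S ∩ A) := by
  by_cases hiS : i ∈ S
  · exact hφ _ _ i Finset.inter_subset_left (Finset.mem_inter.2 ⟨hiS, hi⟩)
  · exact (φ.prob_eq_zero i S hiS).trans_le (φ.prob_nonneg i _)

end ChoiceModel

namespace PersonalizedAssortmentProblem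

variable {n m T : ℕ} (P : PersonalizedAssortmentProblem n m T)

theorem isCompact_setOf_cdlpFeasible : IsCompact {y | P.CDLPFeasible y} := by
  have hset : {y | P.CDLPFeasible y} =
      (Set.univ.pi fun _ => stdSimplex ℝ (Finset (Fin n))) ∩
        ⋂ i, {y : Fin m → Finset (Fin n) → ℝ |
          (T : ℝ) * ∑ k, P.avgTypeProb k * ∑ S, y k S * (P.choice k).prob i S ≤
            P.inventory i} := by
    ext y
    simp only [Set.mem_inter_iff, Set.mem_univ_pi, Set.mem_iInter]
    exact ⟨fun h => ⟨fun k => ⟨h.nonneg k, h.sum_eq_one k⟩, h.inventory_le⟩,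
      fun h => ⟨fun k => (h.1 k).1, fun k => (h.1 k).2, h.2⟩⟩
  rw [hset]
  exact (isCompact_univ_pi fun _ => isCompact_stdSimplex ℝ _).inter_right <|
    isClosed_iInter fun i => isClosed_le (by fun_prop) (by fun_prop)

theorem cdlpFeasible_ite_empty : P.CDLPFeasible fun _ S => if S = ∅ then 1 else 0 where
  nonneg _ _ := by split_ifs <;> norm_num
  sum_eq_one _ := by simp
  inventory_le _ := by simp [ChoiceModel.prob_eq_zero]

theorem exists_cdlpOptimal : ∃ y, P.CDLPOptimal y := by
  have hcont : Continuous P.cdlpObjective := by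
    unfold cdlpObjective
    fun_prop
  obtain ⟨y, hy, hmax⟩ := P.isCompact_setOf_cdlpFeasible.exists_isMaxOn
    ⟨_, P.cdlpFeasible_ite_empty⟩ hcont.continuousOn
  exact ⟨y, hy, fun _ hy' => hmax hy'⟩

/-- The probability that customer `t` buys product `i` if every sampled assortment is offered
without regard to inventory. -/
noncomputable def demandProb (y : Fin m → Finset (Fin n) → ℝ) (i : Fin n) (t : Fin T) : ℝ :=
  ∑ k, P.typeProb t k * ∑ S, y k S * (P.choice k).prob i S

theorem mul_avgTypeProb (k : Fin m) : T * P.avgTypeProb k = ∑ t, P.typeProb t k := by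
  rcases T.eq_zero_or_pos with rfl | hT
  · simp
  · exact mul_div_cancel₀ _ (by positivity)

theorem sum_demandProb (y : Fin m → Finset (Fin n) → ℝ) (i : Fin n) :
    ∑ t, P.demandProb y i t =
      T * ∑ k, P.avgTypeProb k * ∑ S, y k S * (P.choice k).prob i S := by
  rw [Finset.mul_sum]
  simp only [demandProb, ← mul_assoc (T : ℝ), mul_avgTypeProb, Finset.sum_mul]
  exact Finset.sum_comm

theorem cdlpObjective_eq_sum_demandProb (y : Fin m → Finset (Fin n) → ℝ) :
    P.cdlpObjective y = ∑ i, P.price i * ∑ t, P.demandProb y i t := by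
  simp only [sum_demandProb, cdlpObjective, ChoiceModel.expRevenue_eq_sum_univ, Finset.mul_sum]
  rw [Finset.sum_comm (s := (Finset.univ : Finset (Fin n)))]
  refine Finset.sum_congr rfl fun k _ => ?_
  rw [Finset.sum_comm (s := (Finset.univ : Finset (Fin n)))]
  refine Finset.sum_congr rfl fun S _ => Finset.sum_congr rfl fun i _ => ?_
  ring

/-- The products that are available after the customers with records `h`.  Unlike `available`, it
refers to the past only, as `SequenceLaw.cond` requires. -/
def availableAfter {t : ℕ} (h : Fin t → CustomerRecord n m) : Finset (Fin n) :=
  {i | #{s | (h s).2.2 = some i} < P.inventory i}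

theorem availableAfter_take (ω : Fin T → CustomerRecord n m) (t : Fin T) :
    P.availableAfter (Fin.take t t.is_le' ω) = P.available ω t := by
  have hcard (i : Fin n) : #{s : Fin t | (Fin.take t t.is_le' ω s).2.2 = some i} =
      #{s : Fin T | s < t ∧ (ω s).2.2 = some i} :=
    Finset.card_nbij (Fin.castLE t.is_le')
      (fun s hs => Finset.mem_filter.2
        ⟨Finset.mem_univ _, s.is_lt, (Finset.mem_filter.1 hs).2⟩)
      (Fin.castLE_injective _).injOn
      (fun s hs => by
        obtain ⟨-, hst, hs⟩ := Finset.mem_filter.1 hs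
        exact ⟨⟨s, hst⟩, Finset.mem_filter.2 ⟨Finset.mem_univ _, hs⟩, rfl⟩)
  simp only [availableAfter, available, hcard]

theorem demandProb_nonneg {y : Fin m → Finset (Fin n) → ℝ} (hy : ∀ k S, 0 ≤ y k S) (i : Fin n)
    (t : Fin T) : 0 ≤ P.demandProb y i t :=
  Finset.sum_nonneg fun _ _ => mul_nonneg (P.typeProb_nonneg _ _) <|
    Finset.sum_nonneg fun _ _ => mul_nonneg (hy _ _) (ChoiceModel.prob_nonneg _ _ _)

variable {P} {y : Fin m → Finset (Fin n) → ℝ}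

theorem CDLPOptimal.cdlpValue_eq (hy : P.CDLPOptimal y) : P.cdlpValue = P.cdlpObjective y :=
  IsGreatest.csSup_eq ⟨⟨y, hy.1, rfl⟩, by rintro _ ⟨y', hy', rfl⟩; exact hy.2 y' hy'⟩

namespace CDLPFeasible

/-- The law of the customer records under the policy that samples from `y`. -/
noncomputable def policyLaw (hy : P.CDLPFeasible y) : SequenceLaw (CustomerRecord n m) T where
  cond t h a := P.typeProb t a.1 * y a.1 a.2.1 *
    (P.choice a.1).outcomeProb (a.2.1 ∩ P.availableAfter h) a.2.2
  cond_nonneg _ _ _ := mul_nonneg (mul_nonneg (P.typeProb_nonneg _ _) (hy.nonneg _ _))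
    (ChoiceModel.outcomeProb_nonneg _ _ _)
  sum_cond _ _ := by
    simp only [Fintype.sum_prod_type, ← Finset.mul_sum, ChoiceModel.sum_outcomeProb, mul_one,
      hy.sum_eq_one, P.sum_typeProb]

theorem policyLaw_prob (hy : P.CDLPFeasible y) (ω : Fin T → CustomerRecord n m) :
    hy.policyLaw.prob ω = P.pathProb y ω := by
  simp only [SequenceLaw.prob, policyLaw, availableAfter_take, pathProb]

theorem expect_policyLaw_card (hy : P.CDLPFeasible y) (i : Fin n) :
    (hy.policyLaw.expect fun ω => #{t | (ω t).2.2 = some i}) = P.expSales y i := by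
  simp only [SequenceLaw.expect, policyLaw_prob, expSales]

theorem sum_policyLaw_cond_purchase (hy : P.CDLPFeasible y) (t : Fin T)
    (h : Fin t → CustomerRecord n m) (i : Fin n) :
    ∑ a with a.2.2 = some i, hy.policyLaw.cond t h a =
      ∑ k, P.typeProb t k * ∑ S, y k S * (P.choice k).prob i (S ∩ P.availableAfter h) := by
  simp [policyLaw, Finset.sum_filter, Fintype.sum_prod_type, ChoiceModel.outcomeProb,
    Finset.mul_sum, mul_assoc]

theorem demandProb_le_sum_policyLaw_cond (hy : P.CDLPFeasible y)
    (hP : ∀ k, (P.choice k).WeaklySubstitutable) (t : Fin T) (h : Fin t → CustomerRecord n m)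
    {i : Fin n} (hi : i ∈ P.availableAfter h) :
    P.demandProb y i t ≤ ∑ a with a.2.2 = some i, hy.policyLaw.cond t h a := by
  rw [sum_policyLaw_cond_purchase, demandProb]
  gcongr with k _ S _
  · exact P.typeProb_nonneg t k
  · exact hy.nonneg k S
  · exact (hP k).prob_le_prob_inter hi S

theorem expSaturation_le_expSales (hy : P.CDLPFeasible y)
    (hP : ∀ k, (P.choice k).WeaklySubstitutable) (i : Fin n) :
    expSaturation (P.inventory i) (∑ t, P.demandProb y i t) ≤ P.expSales y i := by
  rw [← hy.expect_policyLaw_card]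
  exact hy.policyLaw.expSaturation_le_expect_card (fun a => a.2.2 = some i) (P.inventory i)
    (P.demandProb_nonneg hy.nonneg i) fun t h hlt =>
      hy.demandProb_le_sum_policyLaw_cond hP t h (Finset.mem_filter.2 ⟨Finset.mem_univ i, hlt⟩)

theorem one_sub_one_div_exp_one_mul_le_expSales (hy : P.CDLPFeasible y)
    (hP : ∀ k, (P.choice k).WeaklySubstitutable) (i : Fin n) :
    (1 - 1 / Real.exp 1) * ∑ t, P.demandProb y i t ≤ P.expSales y i := by
  have hdemand : ∑ t, P.demandProb y i t ≤ P.inventory i :=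
    (P.sum_demandProb y i).trans_le (hy.inventory_le i)
  exact (one_sub_one_div_exp_one_mul_le_expSaturation
    (Finset.sum_nonneg fun t _ => P.demandProb_nonneg hy.nonneg i t) hdemand).trans
      (hy.expSaturation_le_expSales hP i)

end CDLPFeasible

end PersonalizedAssortmentProblem

theorem mainTheorem7_general {n m T : ℕ} (P : PersonalizedAssortmentProblem n m T)
    (hP : ∀ k, (P.choice k).WeaklySubstitutable) {y : Fin m → Finset (Fin n) → ℝ}
    (hy : P.CDLPFeasible y) :
    (1 - 1 / Real.exp 1) * P.cdlpObjective y ≤ P.expRevenue y := by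
  rw [P.cdlpObjective_eq_sum_demandProb, Finset.mul_sum]
  refine Finset.sum_le_sum fun i _ => ?_
  rw [mul_left_comm]
  exact mul_le_mul_of_nonneg_left (hy.one_sub_one_div_exp_one_mul_le_expSales hP i)
    (P.price_nonneg i)

theorem mainTheorem7 {n m T : ℕ} (P : PersonalizedAssortmentProblem n m T)
    (hP : ∀ k, (P.choice k).WeaklySubstitutable) :
    (∃ y : Fin m → Finset (Fin n) → ℝ, P.CDLPOptimal y) ∧
      ∀ y : Fin m → Finset (Fin n) → ℝ, P.CDLPOptimal y →
        (1 - 1 / Real.exp 1) * P.cdlpValue ≤ P.expRevenue y :=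
  ⟨P.exists_cdlpOptimal, fun _ hy => hy.cdlpValue_eq ▸ mainTheorem7_general P hP hy.1⟩
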